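/- Let $\Gamma=(V,E)$ be a finite simple graph with $N\ge 1$ edges $e_1,\dots,e_N$. Identify each edge $e_j$ with the interval $[0,1]$, so that one of its two end vertices corresponds to the parameter $0$ and the other one to the parameter $1$ (an arbitrary choice for each edge). For a vertex $v$ put $d_{v,j}=1$ if $v$ is the end of $e_j$ with parameter $1$, $d_{v,j}=-1$ if $v$ is the end of $e_j$ with parameter $0$, and $d_{v,j}=0$ if $v\notin e_j$. For $u=(u_1,\dots,u_N)$ and $v\in e_j$ let $u_j(v)$ and $u_j'(v)$ denote the values of $u_j:[0,1]\to\mathbb C$ and of its (one-sided) derivative at the parameter of $v$. Let $-\Delta$ be the operator $(u_j)_j\mapsto(-u_j'')_j$ in $C([0,1];\mathbb C)^N$ whose domain consists of all $u\in C^2([0,1];\mathbb C)^N$ satisfying the $KC$-condition (anti-Kirchhoff condition) $$\sum_{j=1}^N d_{v,j}^2\,u_j(v)=0\quad\text{for all }v\in V,\qquad d_{v,j}\,u_j'(v)=d_{v,s}\,u_s'(v)\quad\text{whenever } v\in e_j\cap e_s .$$ Then for every $\mu\in\mathbb C$ the geometric and the algebraic multiplicity of $\mu$ for $-\Delta$ coincide.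 Moreover, all eigenvalues of $-\Delta$ are real and, counted according to their multiplicities, they can be arranged in an infinite sequence $\lambda_1\le\lambda_2\le\cdots$; and this sequence satisfies $$\lim_{k\to\infty}\frac{\lambda_k}{k^2}=\frac{\pi^2}{N^2}.$$ -/

import Mathlib

open Set

noncomputable section

namespace KCGraph

/-! ### Multiplicities of eigenvalues of a partially defined linear operator -/

section Multiplicity

variable {X : Type*} [AddCommGroup X] [Module ℂ X]

/-- `genEigenspace T μ k` is the kernel of `(T - μ)^k`: it is `0` for `k = 0`, and `u` belongs to
`genEigenspace T μ (k + 1)` iff `u ∈ D(T)` and `T u - μ u ∈ genEigenspace T μ k`. -/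
def genEigenspace (T : X →ₗ.[ℂ] X) (μ : ℂ) : ℕ → Submodule ℂ X
  | 0 => ⊥
  | k + 1 => ((genEigenspace T μ k).comap (T.toFun - μ • T.domain.subtype)).map T.domain.subtype

/-- The eigenspace `{u ∈ D(T) | T u = μ u}`. -/
def eigenspace (T : X →ₗ.[ℂ] X) (μ : ℂ) : Submodule ℂ X := genEigenspace T μ 1

theorem mem_eigenspace {T : X →ₗ.[ℂ] X} {μ : ℂ} {u : X} :
    u ∈ eigenspace T μ ↔ ∃ h : u ∈ T.domain, T ⟨u, h⟩ = μ • u := by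
  simp [eigenspace, genEigenspace, sub_eq_zero]

/-- The geometric multiplicity of `μ` (it is `0` iff `μ` is not an eigenvalue). -/
def geomMult (T : X →ₗ.[ℂ] X) (μ : ℂ) : ℕ∞ :=
  Cardinal.toENat (Module.rank ℂ (eigenspace T μ))

/-- The algebraic multiplicity of `μ`: the dimension of the space of all generalized
eigenvectors. -/
def algMult (T : X →ₗ.[ℂ] X) (μ : ℂ) : ℕ∞ :=
  Cardinal.toENat (Module.rank ℂ (⨆ k, genEigenspace T μ k : Submodule ℂ X))

/-- `lam 0 ≤ lam 1 ≤ ⋯` lists all eigenvalues of `T`, each repeated according to its geometric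
multiplicity; `lam k` is the `(k + 1)`-st eigenvalue. Since `μ` ranges over `ℂ`, this includes
that all eigenvalues are real. -/
structure IsEigenvalueSequence (T : X →ₗ.[ℂ] X) (lam : ℕ → ℝ) : Prop where
  monotone : Monotone lam
  encard_eq : ∀ μ : ℂ, {k : ℕ | (lam k : ℂ) = μ}.encard = geomMult T μ

end Multiplicity

/-! ### Functions of class `C²` on the closed unit interval -/

/-- The extension of `f : [0,1] → ℂ` to the line (only its restriction to `[0,1]` matters). -/
def lineExt (f : C(unitInterval, ℂ)) : ℝ → ℂ := IccExtend zero_le_one f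

/-- `f ∈ C²[0,1]`, with one-sided derivatives at the end points. -/
def IsC2 (f : C(unitInterval, ℂ)) : Prop := ContDiffOn ℝ 2 (lineExt f) (Icc 0 1)

/-- `f'(x)`, one-sided at the end points. -/
def der (f : C(unitInterval, ℂ)) (x : unitInterval) : ℂ := derivWithin (lineExt f) (Icc 0 1) x

theorem lineExt_add (f g : C(unitInterval, ℂ)) : lineExt (f + g) = lineExt f + lineExt g := rfl

theorem lineExt_smul (c : ℂ) (f : C(unitInterval, ℂ)) : lineExt (c • f) = c • lineExt f := rfl

theorem IsC2.add {f g : C(unitInterval, ℂ)} (hf : IsC2 f) (hg : IsC2 g) : IsC2 (f + g) := by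
  unfold IsC2; rw [lineExt_add]; exact ContDiffOn.add hf hg

theorem IsC2.smul {f : C(unitInterval, ℂ)} (c : ℂ) (hf : IsC2 f) : IsC2 (c • f) := by
  unfold IsC2; rw [lineExt_smul]; exact ContDiffOn.const_smul c hf

theorem isC2_zero : IsC2 0 := by
  have h : lineExt 0 = fun _ => (0 : ℂ) := rfl
  unfold IsC2; rw [h]; exact contDiffOn_const

theorem IsC2.differentiableWithinAt {f : C(unitInterval, ℂ)} (hf : IsC2 f) (x : unitInterval) :
    DifferentiableWithinAt ℝ (lineExt f) (Icc 0 1) x :=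
  ContDiffOn.differentiableOn hf (by norm_num) x x.2

theorem der_add {f g : C(unitInterval, ℂ)} (hf : IsC2 f) (hg : IsC2 g) (x : unitInterval) :
    der (f + g) x = der f x + der g x := by
  unfold der; rw [lineExt_add]
  exact derivWithin_add (hf.differentiableWithinAt x) (hg.differentiableWithinAt x)

theorem der_smul {f : C(unitInterval, ℂ)} (c : ℂ) (hf : IsC2 f) (x : unitInterval) :
    der (c • f) x = c * der f x := by
  unfold der; rw [lineExt_smul]
  exact derivWithin_const_smul c (hf.differentiableWithinAt x)

theorem der_zero (x : unitInterval) : der 0 x = 0 := by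
  have h : lineExt 0 = fun _ => (0 : ℂ) := rfl
  unfold der; rw [h]; simp

/-- `f''` as a continuous function on `[0,1]`, for `f ∈ C²[0,1]`. -/
def der2 (f : C(unitInterval, ℂ)) (hf : IsC2 f) : C(unitInterval, ℂ) where
  toFun x := iteratedDerivWithin 2 (lineExt f) (Icc 0 1) x
  continuous_toFun := continuousOn_iff_continuous_domRestrict.1
    (ContDiffOn.continuousOn_iteratedDerivWithin hf le_rfl (uniqueDiffOn_Icc zero_lt_one))

/-! ### Oriented graphs and the anti-Kirchhoff condition -/

/-- A parametrization of the edges of `Γ` by `[0,1]`, up to the choice of curves: the edge `e` runs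
from `tail e` (parameter `0`) to `head e` (parameter `1`). -/
structure Orientation {V : Type*} (Γ : SimpleGraph V) where
  tail : Γ.edgeSet → V
  head : Γ.edgeSet → V
  edge_eq : ∀ e : Γ.edgeSet, s(tail e, head e) = (e : Sym2 V)

variable {V : Type*} [Fintype V] [DecidableEq V] {Γ : SimpleGraph V} [DecidableRel Γ.Adj]

/-- The signed incidence matrix `d`: `1` at the head, `-1` at the tail, `0` otherwise. -/
def Orientation.d (o : Orientation Γ) (v : V) (e : Γ.edgeSet) : ℂ :=
  if o.head e = v then 1 else if o.tail e = v then -1 else 0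

/-- The parameter in `[0,1]` of the vertex `v` on the edge `e` (meaningful if `v ∈ e`). -/
def Orientation.pos (o : Orientation Γ) (v : V) (e : Γ.edgeSet) : unitInterval :=
  if o.head e = v then 1 else 0

/-- The space `C[0,1]^N` of families of continuous functions, one for each edge. -/
abbrev EdgeFun (Γ : SimpleGraph V) : Type _ := Γ.edgeSet → C(unitInterval, ℂ)

/-- The domain of `Δ`: families `u ∈ C²[0,1]^N` that satisfy the `KC`-condition, i.e. at each vertex
the values sum up to `0`, and the outer normal derivatives along all incident edges agree. -/
def kcDomain (o : Orientation Γ) : Submodule ℂ (EdgeFun Γ) where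
  carrier := {u | (∀ e, IsC2 (u e)) ∧
    (∀ v, ∑ e, o.d v e ^ 2 * u e (o.pos v e) = 0) ∧
    (∀ v, ∀ e f : Γ.edgeSet, v ∈ (e : Sym2 V) → v ∈ (f : Sym2 V) →
      o.d v e * der (u e) (o.pos v e) = o.d v f * der (u f) (o.pos v f))}
  add_mem' := by
    rintro u w ⟨hu, hu1, hu2⟩ ⟨hw, hw1, hw2⟩
    refine ⟨fun e => (hu e).add (hw e), fun v => ?_, fun v e f he hf => ?_⟩
    · simp [mul_add, Finset.sum_add_distrib, hu1 v, hw1 v]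
    · simp only [Pi.add_apply]
      rw [der_add (hu e) (hw e), der_add (hu f) (hw f), mul_add, mul_add, hu2 v e f he hf,
        hw2 v e f he hf]
  zero_mem' := ⟨fun _ => isC2_zero, by simp, by simp [der_zero]⟩
  smul_mem' := by
    rintro c u ⟨hu, hu1, hu2⟩
    refine ⟨fun e => (hu e).smul c, fun v => ?_, fun v e f he hf => ?_⟩
    · have : ∀ e, o.d v e ^ 2 * (c • u) e (o.pos v e) = c * (o.d v e ^ 2 * u e (o.pos v e)) := by
        intro e; simp; ring
      simp only [this, ← Finset.mul_sum, hu1 v, mul_zero]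
    · simp only [Pi.smul_apply]
      rw [der_smul c (hu e), der_smul c (hu f), mul_left_comm, hu2 v e f he hf, mul_left_comm]

/-- The operator `-Δ : u ↦ (-u_e'')_e` in `C[0,1]^N`, under the `KC`-condition. -/
def negLaplacianKC (o : Orientation Γ) : EdgeFun Γ →ₗ.[ℂ] EdgeFun Γ where
  domain := kcDomain o
  toFun :=
    { toFun := fun u e => -der2 (u.1 e) (u.2.1 e)
      map_add' := by
        intro u w
        funext e
        ext x
        have h := iteratedDerivWithin_add x.2 (uniqueDiffOn_Icc zero_lt_one)
          (ContDiffOn.contDiffWithinAt (u.2.1 e) x.2) (ContDiffOn.contDiffWithinAt (w.2.1 e) x.2)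
        have h' : der2 ((u + w).1 e) ((u + w).2.1 e) x
            = der2 (u.1 e) (u.2.1 e) x + der2 (w.1 e) (w.2.1 e) x := h
        simp only [Pi.add_apply, ContinuousMap.add_apply, ContinuousMap.neg_apply, h', neg_add]
      map_smul' := by
        intro c u
        funext e
        ext x
        have h := iteratedDerivWithin_const_smul x.2 (uniqueDiffOn_Icc zero_lt_one) c
          (ContDiffOn.contDiffWithinAt (u.2.1 e) x.2)
        have h' : der2 ((c • u).1 e) ((c • u).2.1 e) x = c • der2 (u.1 e) (u.2.1 e) x := h
        simp only [Pi.smul_apply, ContinuousMap.smul_apply, ContinuousMap.neg_apply, h', smul_neg,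
          RingHom.id_apply] }

end KCGraph

end

/-!
Call a pair of an edge and one of its ends a dart. The anti-Kirchhoff condition says that the vector
of outer normal derivatives, indexed by the darts, lies in the space `K` of vectors that are
constant at each vertex, and that the vector of boundary values lies in `Kᗮ`. Any subspace `K` gives
a symmetric operator for the `L²` inner product, and so generalized eigenvectors are eigenvectors.

An eigenfunction for `κ² ≠ 0` is on each edge a superposition of the waves `exp(iκx)` and
`exp(iκ(1 - x))`, and in terms of the amplitudes the boundary conditions read `S c = exp(iκ) c`. The
point is that `S`, the reflection in `Kᗮ` followed by the exchange of the ends of each edge, is an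
isometry that does not depend on `κ`. If `exp(iθ_j)`, for `j = 1, …, 2N`, are its eigenvalues, then
the nonzero eigenvalues of the operator are the squares of the numbers `θ_j + 2πq`, and these have
average distance `2π / (2N) = π / N`.
-/

noncomputable section

namespace KCGraph

section SymmetricOperators

variable {X H : Type*} [AddCommGroup X] [Module ℂ X] [NormedAddCommGroup H]
  [InnerProductSpace ℂ H] {T : X →ₗ.[ℂ] X} {J : X →ₗ[ℂ] H}

theorem sub_smul_eq_zero_of_symmetric (hJ : Function.Injective J)
    (hT : ∀ u w : T.domain, inner ℂ (J (T u)) (J w) = inner ℂ (J u) (J (T w)))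
    {μ : ℂ} {u : T.domain} (hu : T u - μ • (u : X) ∈ eigenspace T μ) :
    T u - μ • (u : X) = 0 := by
  set w := T u - μ • (u : X) with hw_def
  obtain ⟨hw, hTw⟩ := mem_eigenspace.1 hu
  by_contra hw0
  have hJw : inner ℂ (J w) (J w) ≠ 0 := by simpa [map_eq_zero_iff J hJ] using hw0
  have hμ : starRingEnd ℂ μ = μ := by
    have h := hT ⟨w, hw⟩ ⟨w, hw⟩
    rw [hTw, map_smul, inner_smul_left, inner_smul_right] at h
    exact mul_right_cancel₀ hJw h
  have h := hT ⟨w, hw⟩ u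
  rw [hTw, map_smul, inner_smul_left, hμ, ← inner_smul_right, ← sub_eq_zero, ← inner_sub_right,
    ← map_smul, ← map_sub, ← neg_sub, ← hw_def, map_neg, inner_neg_right, neg_eq_zero] at h
  exact hJw h

theorem geomMult_eq_algMult_of_symmetric (hJ : Function.Injective J)
    (hT : ∀ u w : T.domain, inner ℂ (J (T u)) (J w) = inner ℂ (J u) (J (T w))) (μ : ℂ) :
    geomMult T μ = algMult T μ := by
  have hle : ∀ k, genEigenspace T μ k ≤ eigenspace T μ := by
    intro k
    induction k with
    | zero => exact bot_le
    | succ k ih =>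
      rintro _ ⟨u, hu, rfl⟩
      exact mem_eigenspace.2 ⟨u.2, sub_eq_zero.1 (sub_smul_eq_zero_of_symmetric hJ hT (ih hu))⟩
  rw [geomMult, algMult, le_antisymm (iSup_le hle) (le_iSup (genEigenspace T μ) 1), eigenspace]

end SymmetricOperators

section Isometries

open Module

variable {𝕜 H : Type*} [RCLike 𝕜] [NormedAddCommGroup H]

theorem isSemisimple_linearIsometry [InnerProductSpace 𝕜 H] [FiniteDimensional 𝕜 H]
    (T : H →ₗᵢ[𝕜] H) : End.IsSemisimple (T.toLinearMap : End 𝕜 H) := by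
  refine End.isSemisimple_iff.2 fun p hp =>
    ⟨pᗮ, fun x hx y hy => ?_, Submodule.isCompl_orthogonal p⟩
  have hmap : p.map T.toLinearMap = p :=
    Submodule.eq_of_le_of_finrank_eq (Submodule.map_le_iff_le_comap.2 hp)
      (Submodule.equivMapOfInjective _ T.injective p).finrank_eq.symm
  obtain ⟨y', hy', rfl⟩ : y ∈ p.map T.toLinearMap := hmap.ge hy
  exact (T.inner_map_map y' x).trans (hx y' hy')

theorem norm_eq_one_of_hasEigenvalue [NormedSpace 𝕜 H] (T : H →ₗᵢ[𝕜] H) {z : 𝕜}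
    (hz : End.HasEigenvalue (T.toLinearMap : End 𝕜 H) z) : ‖z‖ = 1 := by
  obtain ⟨v, hv⟩ := hz.exists_hasEigenvector
  have h : ‖z‖ * ‖v‖ = ‖v‖ := by
    rw [← norm_smul, ← hv.apply_eq_smul]; exact T.norm_map v
  exact (mul_eq_right₀ (norm_ne_zero_iff.2 hv.2)).1 h

variable [InnerProductSpace ℂ H] [FiniteDimensional ℂ H]

theorem exists_eigenvalues_of_linearIsometry (T : H →ₗᵢ[ℂ] H) :
    ∃ z : Fin (finrank ℂ H) → ℂ, (∀ j, ‖z j‖ = 1) ∧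
      ∀ ζ, {j | z j = ζ}.encard = finrank ℂ (End.eigenspace T.toLinearMap ζ) := by
  obtain ⟨L, hL⟩ := Quot.exists_rep T.toLinearMap.charpoly.roots
  change (L : Multiset ℂ) = _ at hL
  have hlen : L.length = finrank ℂ H := by
    rw [← Multiset.coe_card, hL, (Polynomial.splits_iff_card_roots).1 (IsAlgClosed.splits _),
      LinearMap.charpoly_natDegree]
  rw [← hlen]
  refine ⟨L.get, fun j => norm_eq_one_of_hasEigenvalue T ?_, fun ζ => ?_⟩
  · rw [End.hasEigenvalue_iff_isRoot_charpoly]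
    exact Polynomial.isRoot_of_mem_roots (hL ▸ L.get_mem j)
  · rw [← (isSemisimple_linearIsometry T).isFinitelySemisimple.maxGenEigenspace_eq_eigenspace,
      LinearMap.finrank_maxGenEigenspace_eq, ← Polynomial.count_roots, ← hL, Multiset.coe_count,
      ← Finset.coe_filter_univ, Set.encard_coe_eq_coe_finsetCard]
    exact congrArg Nat.cast (Fin.card_filter_univ_eq_vector_get_eq_count ζ ⟨L, rfl⟩)

theorem exists_monotone_angles_of_linearIsometry (T : H →ₗᵢ[ℂ] H) :
    ∃ θ : Fin (finrank ℂ H) → ℝ, Monotone θ ∧ (∀ j, θ j ∈ Ioc 0 (2 * Real.pi)) ∧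
      ∀ ζ, {j | Complex.exp (θ j * Complex.I) = ζ}.encard
        = finrank ℂ (End.eigenspace T.toLinearMap ζ) := by
  obtain ⟨z, hz, hcount⟩ := exists_eigenvalues_of_linearIsometry T
  have hangle : ∀ j, ∃ θ : ℝ, θ ∈ Ioc 0 (2 * Real.pi) ∧ Complex.exp (θ * Complex.I) = z j := by
    intro j
    obtain ⟨t, ht⟩ := (Complex.norm_eq_one_iff _).1 (hz j)
    obtain ⟨θ, hθ, hexp⟩ := Circle.periodic_exp.exists_mem_Ioc Real.two_pi_pos t 0
    refine ⟨θ, by simpa using hθ, ?_⟩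
    rw [← Circle.coe_exp, ← hexp, Circle.coe_exp, ht]
  choose θ hθ hexp using hangle
  refine ⟨θ ∘ Tuple.sort θ, Tuple.monotone_sort θ, fun j => hθ _, fun ζ => ?_⟩
  simp only [Function.comp_apply, hexp]
  rw [← hcount, ← (Tuple.sort θ).injective.encard_image, Equiv.image_eq_preimage_symm]
  simp

end Isometries

section UnitInterval

open MeasureTheory

theorem lineExt_apply (f : C(unitInterval, ℂ)) {x : ℝ} (hx : x ∈ Icc (0 : ℝ) 1) :
    lineExt f x = f ⟨x, hx⟩ :=
  IccExtend_of_mem _ _ hx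

/-- `f'` as a function on the line; as for `lineExt`, only its restriction to `[0,1]` matters. -/
def lineDer (f : C(unitInterval, ℂ)) : ℝ → ℂ := derivWithin (lineExt f) (Icc 0 1)

theorem IsC2.hasDerivWithinAt {f : C(unitInterval, ℂ)} (hf : IsC2 f) (x : unitInterval) :
    HasDerivWithinAt (lineExt f) (der f x) (Icc 0 1) x :=
  (hf.differentiableWithinAt x).hasDerivWithinAt

theorem IsC2.hasDerivWithinAt_lineDer {f : C(unitInterval, ℂ)} (hf : IsC2 f) (x : unitInterval) :
    HasDerivWithinAt (lineDer f) (der2 f hf x) (Icc 0 1) x := by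
  have hd : DifferentiableOn ℝ (lineDer f) (Icc 0 1) :=
    (ContDiffOn.derivWithin hf (uniqueDiffOn_Icc zero_lt_one) (m := 1) one_add_one_eq_two.le)
      |>.differentiableOn one_ne_zero
  have h : der2 f hf x = derivWithin (lineDer f) (Icc 0 1) x :=
    iteratedDerivWithin_eq_iterate (n := 2)
  exact h ▸ (hd x x.2).hasDerivWithinAt

theorem der2_add {f g : C(unitInterval, ℂ)} (hf : IsC2 f) (hg : IsC2 g) :
    der2 (f + g) (hf.add hg) = der2 f hf + der2 g hg :=
  ContinuousMap.ext fun x => iteratedDerivWithin_add x.2 (uniqueDiffOn_Icc zero_lt_one)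
    (ContDiffOn.contDiffWithinAt hf x.2) (ContDiffOn.contDiffWithinAt hg x.2)

theorem der2_smul {f : C(unitInterval, ℂ)} (c : ℂ) (hf : IsC2 f) :
    der2 (c • f) (hf.smul c) = c • der2 f hf :=
  ContinuousMap.ext fun x => iteratedDerivWithin_const_smul x.2 (uniqueDiffOn_Icc zero_lt_one) c
    (ContDiffOn.contDiffWithinAt hf x.2)

theorem eqOn_lineExt_restrict (F : C(ℝ, ℂ)) :
    EqOn (lineExt (F.restrict unitInterval)) F (Icc 0 1) :=
  fun _ hx => lineExt_apply _ hx

theorem isC2_restrict {F : C(ℝ, ℂ)} (hF : ContDiff ℝ 2 F) : IsC2 (F.restrict unitInterval) :=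
  hF.contDiffOn.congr (eqOn_lineExt_restrict F)

theorem der_restrict {F : C(ℝ, ℂ)} {F' : ℂ} {x : unitInterval} (h : HasDerivAt F F' (x : ℝ)) :
    der (F.restrict unitInterval) x = F' :=
  (h.hasDerivWithinAt.congr (eqOn_lineExt_restrict F) (eqOn_lineExt_restrict F x.2)).derivWithin
    (uniqueDiffOn_Icc zero_lt_one x x.2)

theorem der2_restrict {F F' F'' : C(ℝ, ℂ)} (hF : ContDiff ℝ 2 F)
    (h : ∀ x, HasDerivAt F (F' x) x) (h' : ∀ x, HasDerivAt F' (F'' x) x) :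
    der2 (F.restrict unitInterval) (isC2_restrict hF) = F''.restrict unitInterval := by
  have hder : EqOn (lineDer (F.restrict unitInterval)) F' (Icc 0 1) := fun y hy =>
    der_restrict (x := ⟨y, hy⟩) (h y)
  ext x
  exact (uniqueDiffOn_Icc zero_lt_one x x.2).eq_deriv _
    ((isC2_restrict hF).hasDerivWithinAt_lineDer x)
    ((h' x).hasDerivWithinAt.congr hder (hder x.2))

theorem eq_of_neg_der2_eq_smul {μ : ℂ} {f g : C(unitInterval, ℂ)} (hf : IsC2 f) (hg : IsC2 g)
    (hf' : -der2 f hf = μ • f) (hg' : -der2 g hg = μ • g) (h0 : f 0 = g 0)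
    (h1 : der f 0 = der g 0) : f = g := by
  let v : ℂ × ℂ →L[ℝ] ℂ × ℂ :=
    ((ContinuousLinearMap.snd ℂ ℂ ℂ).prod (-(μ • ContinuousLinearMap.fst ℂ ℂ ℂ))).restrictScalars ℝ
  have hsol : ∀ {h : C(unitInterval, ℂ)} (hh : IsC2 h), -der2 h hh = μ • h →
      ∀ t ∈ Icc (0 : ℝ) 1, HasDerivWithinAt (fun t => (lineExt h t, lineDer h t))
        (v (lineExt h t, lineDer h t)) (Icc 0 1) t := by
    intro h hh heq t ht
    have hv : v (lineExt h t, lineDer h t) = (der h ⟨t, ht⟩, der2 h hh ⟨t, ht⟩) := by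
      refine Prod.ext rfl (neg_eq_iff_eq_neg.2 ?_)
      rw [lineExt_apply h ht]
      exact (DFunLike.congr_fun heq _).symm
    rw [hv]
    exact (hh.hasDerivWithinAt ⟨t, ht⟩).prodMk (hh.hasDerivWithinAt_lineDer ⟨t, ht⟩)
  have hright : ∀ {t : ℝ}, t ∈ Ico (0 : ℝ) 1 → Icc (0 : ℝ) 1 ∈ nhdsWithin t (Ici t) := fun ht =>
    Filter.mem_of_superset (Icc_mem_nhdsGE ht.2) (Icc_subset_Icc_left ht.1)
  have hfg := ODE_solution_unique_of_mem_Icc_right (v := fun _ => v) (s := fun _ => univ)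
    (fun t _ => v.lipschitz.lipschitzOnWith)
    (fun t ht => (hsol hf hf' t ht).continuousWithinAt)
    (fun t ht => (hsol hf hf' t (Ico_subset_Icc_self ht)).mono_of_mem_nhdsWithin (hright ht))
    (fun _ _ => mem_univ _)
    (fun t ht => (hsol hg hg' t ht).continuousWithinAt)
    (fun t ht => (hsol hg hg' t (Ico_subset_Icc_self ht)).mono_of_mem_nhdsWithin (hright ht))
    (fun _ _ => mem_univ _) (Prod.ext ((lineExt_apply f ⟨le_rfl, zero_le_one⟩).trans
      (h0.trans (lineExt_apply g ⟨le_rfl, zero_le_one⟩).symm)) h1)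
  ext x
  rw [← lineExt_apply f x.2, ← lineExt_apply g x.2]
  exact congrArg Prod.fst (hfg x.2)

theorem integral_unitInterval_eq_sub {F : ℝ → ℂ} {G : C(unitInterval, ℂ)}
    (h : ∀ x : unitInterval, HasDerivWithinAt F (G x) (Icc 0 1) x) :
    ∫ x, G x = F 1 - F 0 := by
  have hcont : ContinuousOn F (Icc 0 1) := fun x hx => (h ⟨x, hx⟩).continuousWithinAt
  have hderiv : ∀ x ∈ Ioo (0 : ℝ) 1, HasDerivAt F (lineExt G x) x := fun x hx => by
    rw [lineExt_apply G (Ioo_subset_Icc_self hx)]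
    exact (h ⟨x, Ioo_subset_Icc_self hx⟩).hasDerivAt (Icc_mem_nhds hx.1 hx.2)
  rw [← intervalIntegral.integral_eq_sub_of_hasDerivAt_of_le zero_le_one hcont hderiv
      (G.continuous.Icc_extend'.intervalIntegrable 0 1),
    intervalIntegral.integral_of_le zero_le_one, ← integral_Icc_eq_integral_Ioc,
    ← integral_subtype_comap measurableSet_Icc]
  exact integral_congr_ae (.of_forall fun x => (lineExt_apply G x.2).symm)

instance isOpenPosMeasure_unitInterval : (volume : Measure unitInterval).IsOpenPosMeasure where
  open_pos U hU hne hU0 := by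
    obtain ⟨a, b, hab, hsub⟩ := hU.exists_Ioo_subset hne
    have hIoo := measure_mono_null hsub hU0
    rw [unitInterval.volume_Ioo, ENNReal.ofReal_eq_zero, sub_nonpos] at hIoo
    exact hIoo.not_gt hab

end UnitInterval

section Waves

/-- The superposition `x ↦ a exp(iκx) + b exp(iκ(1 - x))` of the two plane waves of frequency `κ`;
`a` and `b` are the amplitudes at the end points where the waves start. -/
def wave (κ a b : ℂ) : C(ℝ, ℂ) where
  toFun x := a * Complex.exp (κ * Complex.I * x) + b * Complex.exp (κ * Complex.I * (1 - x))
  continuous_toFun := by fun_prop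

variable {κ : ℂ} (a b : ℂ)

theorem wave_zero : wave κ a b 0 = a + b * Complex.exp (κ * Complex.I) := by simp [wave]

theorem wave_one : wave κ a b 1 = a * Complex.exp (κ * Complex.I) + b := by simp [wave]

theorem hasDerivAt_wave (x : ℝ) :
    HasDerivAt (wave κ a b) (wave κ (κ * Complex.I * a) (-(κ * Complex.I * b)) x) x := by
  have hright := ((Complex.ofRealCLM.hasDerivAt (x := x)).const_mul (κ * Complex.I)).cexp
  have hleft := (((Complex.ofRealCLM.hasDerivAt (x := x)).const_sub 1).const_mul
    (κ * Complex.I)).cexp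
  refine ((hright.const_mul a).add (hleft.const_mul b)).congr_deriv ?_
  simp only [wave, ContinuousMap.coe_mk, Complex.ofRealCLM_apply, Complex.ofReal_one]
  ring

theorem contDiff_wave : ContDiff ℝ 2 (wave κ a b) := by
  have h : ContDiff ℝ 2 (fun x : ℝ => (x : ℂ)) := Complex.ofRealCLM.contDiff
  exact (contDiff_const.mul (contDiff_const.mul h).cexp).add
    (contDiff_const.mul (contDiff_const.mul (contDiff_const.sub h)).cexp)

theorem neg_der2_wave :
    -der2 ((wave κ a b).restrict unitInterval) (isC2_restrict (contDiff_wave a b))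
      = κ ^ 2 • (wave κ a b).restrict unitInterval := by
  rw [der2_restrict (contDiff_wave a b) (hasDerivAt_wave a b) (hasDerivAt_wave _ _)]
  ext x
  simp only [wave, ContinuousMap.neg_apply, ContinuousMap.smul_apply, ContinuousMap.restrict_apply,
    ContinuousMap.coe_mk, smul_eq_mul]
  linear_combination (-κ ^ 2 * (a * Complex.exp (κ * Complex.I * x)
    + b * Complex.exp (κ * Complex.I * (1 - x)))) * Complex.I_sq

theorem exists_eq_wave {f : C(unitInterval, ℂ)} (hf : IsC2 f) (hκ : κ ≠ 0)
    (h : -der2 f hf = κ ^ 2 • f) : ∃ a b, f = (wave κ a b).restrict unitInterval := by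
  set s := der f 0 / (κ * Complex.I)
  have hs : κ * Complex.I * s = der f 0 := mul_div_cancel₀ _ (mul_ne_zero hκ Complex.I_ne_zero)
  have hexp : Complex.exp (-(κ * Complex.I)) * Complex.exp (κ * Complex.I) = 1 := by
    rw [← Complex.exp_add, neg_add_cancel, Complex.exp_zero]
  refine ⟨(f 0 + s) / 2, (f 0 - s) / 2 * Complex.exp (-(κ * Complex.I)),
    eq_of_neg_der2_eq_smul hf _ h (neg_der2_wave _ _) ?_ ?_⟩
  · rw [ContinuousMap.restrict_apply, Icc.coe_zero, wave_zero]
    linear_combination -(f 0 - s) / 2 * hexp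
  · rw [der_restrict (hasDerivAt_wave _ _ _), Icc.coe_zero, wave_zero]
    linear_combination -hs + κ * Complex.I * (f 0 - s) / 2 * hexp

variable {a b}

theorem eq_zero_of_wave_eq_zero (hκ : κ ≠ 0) (h : (wave κ a b).restrict unitInterval = 0) :
    a = 0 ∧ b = 0 := by
  have hval : a + b * Complex.exp (κ * Complex.I) = 0 :=
    (wave_zero a b).symm.trans (DFunLike.congr_fun h 0)
  have hder : κ * Complex.I * a + -(κ * Complex.I * b) * Complex.exp (κ * Complex.I) = 0 := by
    rw [← wave_zero, ← der_zero 0, ← h]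
    exact (der_restrict (x := 0) (hasDerivAt_wave a b 0)).symm
  have hdiff : a - b * Complex.exp (κ * Complex.I) = 0 :=
    (mul_eq_zero_iff_left (mul_ne_zero hκ Complex.I_ne_zero)).1 (by linear_combination hder)
  have ha : a = 0 := by linear_combination (hval + hdiff) / 2
  rw [ha, zero_add] at hval
  exact ⟨ha, (mul_eq_zero_iff_right (Complex.exp_ne_zero _)).1 hval⟩

end Waves

section Operator

open MeasureTheory Module

variable {ι : Type*}

/-- The end of the edge `[0,1]` that belongs to a dart `(e, b)`: `1` for `b = true`, otherwise
`0`. -/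
def endPoint (b : Bool) : unitInterval := if b then 1 else 0

/-- The sign that turns a derivative at `endPoint b` into an outer normal derivative. -/
def endSign (b : Bool) : ℂ := if b then 1 else -1

/-- The values of `u` at the ends of all edges. -/
def boundaryValue (u : ι → C(unitInterval, ℂ)) : EuclideanSpace ℂ (ι × Bool) :=
  WithLp.toLp 2 fun δ => u δ.1 (endPoint δ.2)

/-- The outer normal derivatives of `u` at the ends of all edges. -/
def normalDer (u : ι → C(unitInterval, ℂ)) : EuclideanSpace ℂ (ι × Bool) :=
  WithLp.toLp 2 fun δ => endSign δ.2 * der (u δ.1) (endPoint δ.2)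

theorem boundaryValue_add (u w : ι → C(unitInterval, ℂ)) :
    boundaryValue (u + w) = boundaryValue u + boundaryValue w := rfl

theorem boundaryValue_smul (c : ℂ) (u : ι → C(unitInterval, ℂ)) :
    boundaryValue (c • u) = c • boundaryValue u := rfl

theorem boundaryValue_zero : boundaryValue (0 : ι → C(unitInterval, ℂ)) = 0 := rfl

theorem normalDer_add {u w : ι → C(unitInterval, ℂ)} (hu : ∀ e, IsC2 (u e))
    (hw : ∀ e, IsC2 (w e)) : normalDer (u + w) = normalDer u + normalDer w := by
  ext δ
  simp only [normalDer, Pi.add_apply, der_add (hu δ.1) (hw δ.1), PiLp.add_apply, mul_add]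

theorem normalDer_smul (c : ℂ) {u : ι → C(unitInterval, ℂ)} (hu : ∀ e, IsC2 (u e)) :
    normalDer (c • u) = c • normalDer u := by
  ext δ
  simp only [normalDer, Pi.smul_apply, der_smul c (hu δ.1), PiLp.smul_apply, smul_eq_mul,
    mul_left_comm]

theorem normalDer_zero : normalDer (0 : ι → C(unitInterval, ℂ)) = 0 := by
  ext δ
  simp only [normalDer, Pi.zero_apply, der_zero, mul_zero, PiLp.zero_apply]

variable [Fintype ι] (K : Submodule ℂ (EuclideanSpace ℂ (ι × Bool)))

/-- The domain of the Laplacian on a disjoint union of unit intervals for the self-adjoint boundary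
conditions given by `K`: the boundary values lie in `Kᗮ` and the outer normal derivatives in `K`. -/
def boundaryDomain : Submodule ℂ (ι → C(unitInterval, ℂ)) where
  carrier := {u | (∀ e, IsC2 (u e)) ∧ boundaryValue u ∈ Kᗮ ∧ normalDer u ∈ K}
  add_mem' := by
    rintro u w ⟨hu, hu0, hu1⟩ ⟨hw, hw0, hw1⟩
    exact ⟨fun e => (hu e).add (hw e), boundaryValue_add u w ▸ Kᗮ.add_mem hu0 hw0,
      normalDer_add hu hw ▸ K.add_mem hu1 hw1⟩
  zero_mem' := ⟨fun _ => isC2_zero, boundaryValue_zero ▸ Kᗮ.zero_mem, normalDer_zero ▸ K.zero_mem⟩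
  smul_mem' := by
    rintro c u ⟨hu, hu0, hu1⟩
    exact ⟨fun e => (hu e).smul c, boundaryValue_smul c u ▸ Kᗮ.smul_mem c hu0,
      normalDer_smul c hu ▸ K.smul_mem c hu1⟩

/-- The operator `u ↦ (-u_e'')_e` with domain `boundaryDomain K`. -/
def negLaplacian : (ι → C(unitInterval, ℂ)) →ₗ.[ℂ] (ι → C(unitInterval, ℂ)) where
  domain := boundaryDomain K
  toFun :=
    { toFun := fun u e => -der2 (u.1 e) (u.2.1 e)
      map_add' := fun u w => funext fun e =>
        (congrArg Neg.neg (der2_add (u.2.1 e) (w.2.1 e))).trans (neg_add _ _)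
      map_smul' := fun c u => funext fun e =>
        (congrArg Neg.neg (der2_smul c (u.2.1 e))).trans (smul_neg _ _).symm }

variable {K}

theorem mem_eigenspace_negLaplacian {μ : ℂ} {u : ι → C(unitInterval, ℂ)} :
    u ∈ eigenspace (negLaplacian K) μ ↔
      ∃ h : u ∈ boundaryDomain K, ∀ e, -der2 (u e) (h.1 e) = μ • u e :=
  mem_eigenspace.trans (exists_congr fun _ => funext_iff)

theorem finiteDimensional_eigenspace_negLaplacian (μ : ℂ) :
    FiniteDimensional ℂ (eigenspace (negLaplacian K) μ) := by
  have hC2 : ∀ (u : eigenspace (negLaplacian K) μ) (e : ι), IsC2 (u.1 e) := fun u =>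
    (mem_eigenspace_negLaplacian.1 u.2).1.1
  let initialData : eigenspace (negLaplacian K) μ →ₗ[ℂ] ι → ℂ × ℂ :=
    { toFun := fun u e => (u.1 e 0, der (u.1 e) 0)
      map_add' := fun u w => funext fun e => Prod.ext rfl (der_add (hC2 u e) (hC2 w e) 0)
      map_smul' := fun c u => funext fun e => Prod.ext rfl (der_smul c (hC2 u e) 0) }
  refine FiniteDimensional.of_injective initialData fun u w huw => Subtype.ext (funext fun e => ?_)
  obtain ⟨hu, hu'⟩ := mem_eigenspace_negLaplacian.1 u.2
  obtain ⟨hw, hw'⟩ := mem_eigenspace_negLaplacian.1 w.2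
  exact eq_of_neg_der2_eq_smul (hu.1 e) (hw.1 e) (hu' e) (hw' e)
    (congrArg Prod.fst (congrFun huw e)) (congrArg Prod.snd (congrFun huw e))

theorem geomMult_negLaplacian (μ : ℂ) :
    geomMult (negLaplacian K) μ = finrank ℂ (eigenspace (negLaplacian K) μ) := by
  have := finiteDimensional_eigenspace_negLaplacian (K := K) μ
  rw [geomMult, ← finrank_eq_rank, map_natCast]

section Symmetry

theorem inner_toLp_der2_sub {f g : C(unitInterval, ℂ)} (hf : IsC2 f) (hg : IsC2 g) :
    inner ℂ (ContinuousMap.toLp 2 volume ℂ f) (ContinuousMap.toLp 2 volume ℂ (der2 g hg))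
        - inner ℂ (ContinuousMap.toLp 2 volume ℂ (der2 f hf)) (ContinuousMap.toLp 2 volume ℂ g)
      = ∑ b, endSign b * (inner ℂ (f (endPoint b)) (der g (endPoint b))
          - inner ℂ (der f (endPoint b)) (g (endPoint b))) := by
  have hint : ∀ h : C(unitInterval, ℂ), Integrable h volume := fun h =>
    h.continuous.integrable_of_hasCompactSupport (HasCompactSupport.of_compactSpace _)
  have hderiv : ∀ x : unitInterval, HasDerivWithinAt
      (fun x => lineDer g x * star (lineExt f x) - lineExt g x * star (lineDer f x))
      ((der2 g hg * star f - g * star (der2 f hf)) x) (Icc 0 1) x := by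
    intro x
    refine (((hg.hasDerivWithinAt_lineDer x).mul (hf.hasDerivWithinAt x).star).sub
      ((hg.hasDerivWithinAt x).mul (hf.hasDerivWithinAt_lineDer x).star)).congr_deriv ?_
    simp only [ContinuousMap.sub_apply, ContinuousMap.mul_apply, ContinuousMap.star_apply,
      lineExt_apply _ x.2]
    change _ + der g x * star (der f x) - (der g x * star (der f x) + _) = _
    ring
  have hFTC := integral_unitInterval_eq_sub hderiv
  rw [ContinuousMap.inner_toLp, ContinuousMap.inner_toLp]
  refine (integral_sub (hint (der2 g hg * star f)) (hint (g * star (der2 f hf)))).symm.trans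
    (hFTC.trans ?_)
  have h0 : ∀ f, lineExt f 0 = f 0 := fun f => lineExt_apply f ⟨le_rfl, zero_le_one⟩
  have h1 : ∀ f, lineExt f 1 = f 1 := fun f => lineExt_apply f ⟨zero_le_one, le_rfl⟩
  simp only [Fintype.sum_bool, endSign, endPoint, RCLike.inner_apply, h0, h1]
  change der g 1 * star (f 1) - g 1 * star (der f 1) - (der g 0 * star (f 0) - g 0 * star (der f 0))
    = _
  simp only [RCLike.star_def, ↓reduceIte, Bool.false_eq_true]
  ring

/-- The embedding of `C[0,1]^ι` into the Hilbert space `L²(0,1)^ι`. -/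
def toL2 :
    (ι → C(unitInterval, ℂ)) →ₗ[ℂ] PiLp 2 fun _ : ι => Lp ℂ 2 (volume : Measure unitInterval) :=
  (WithLp.linearEquiv 2 ℂ (ι → Lp ℂ 2 (volume : Measure unitInterval))).symm.toLinearMap ∘ₗ
    LinearMap.pi fun e => (ContinuousMap.toLp 2 volume ℂ).toLinearMap ∘ₗ LinearMap.proj e

omit [Fintype ι] in
theorem toL2_injective : Function.Injective (toL2 (ι := ι)) := fun _ _ h => funext fun e =>
  ContinuousMap.toLp_injective volume (congrArg (fun x => x e) h)

theorem inner_toL2 (u w : ι → C(unitInterval, ℂ)) :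
    inner ℂ (toL2 u) (toL2 w) = ∑ e, inner ℂ (ContinuousMap.toLp 2 volume ℂ (u e))
      (ContinuousMap.toLp 2 volume ℂ (w e)) := rfl

theorem inner_negLaplacian_sub (u w : (negLaplacian K).domain) :
    inner ℂ (toL2 (negLaplacian K u)) (toL2 w) - inner ℂ (toL2 u) (toL2 (negLaplacian K w))
      = inner ℂ (boundaryValue u.1) (normalDer w.1)
        - inner ℂ (normalDer u.1) (boundaryValue w.1) := by
  have hsign : ∀ b, starRingEnd ℂ (endSign b) = endSign b := by simp [endSign, apply_ite]
  rw [inner_toL2, inner_toL2, ← Finset.sum_sub_distrib, PiLp.inner_apply, PiLp.inner_apply,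
    ← Finset.sum_sub_distrib, Fintype.sum_prod_type]
  refine Finset.sum_congr rfl fun e _ => ?_
  have hedge := inner_toLp_der2_sub (u.2.1 e) (w.2.1 e)
  change inner ℂ (ContinuousMap.toLp 2 volume ℂ (-der2 (u.1 e) (u.2.1 e))) _
    - inner ℂ _ (ContinuousMap.toLp 2 volume ℂ (-der2 (w.1 e) (w.2.1 e))) = _
  rw [map_neg, map_neg, inner_neg_left, inner_neg_right, sub_neg_eq_add, neg_add_eq_sub]
  refine hedge.trans (Finset.sum_congr rfl fun b _ => ?_)
  simp only [boundaryValue, normalDer, RCLike.inner_apply, map_mul, hsign]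
  ring

theorem inner_toL2_negLaplacian (u w : (negLaplacian K).domain) :
    inner ℂ (toL2 (negLaplacian K u)) (toL2 w) = inner ℂ (toL2 u) (toL2 (negLaplacian K w)) := by
  rw [← sub_eq_zero, inner_negLaplacian_sub, Submodule.inner_left_of_mem_orthogonal w.2.2.2 u.2.2.1,
    Submodule.inner_right_of_mem_orthogonal u.2.2.2 w.2.2.1, sub_zero]

end Symmetry

end Operator

section Scattering

open Module

theorem reflection_orthogonal_eq_iff {𝕜 H : Type*} [RCLike 𝕜] [NormedAddCommGroup H]
    [InnerProductSpace 𝕜 H] (K : Submodule 𝕜 H) [K.HasOrthogonalProjection] {x y : H} :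
    Kᗮ.reflection x = y ↔ x + y ∈ Kᗮ ∧ y - x ∈ K := by
  have hK : ∀ v, K.reflection v = -Kᗮ.reflection v := fun v => by
    rw [K.reflection_orthogonal_apply, neg_neg]
  rw [← Submodule.reflection_eq_self_iff (K := Kᗮ), ← Submodule.reflection_eq_self_iff (K := K), hK,
    map_add, map_sub]
  refine ⟨?_, fun ⟨hadd, hsub⟩ => ?_⟩
  · rintro rfl
    rw [Submodule.reflection_reflection]
    exact ⟨add_comm _ _, neg_sub _ _⟩
  · linear_combination (norm := module) (2⁻¹ : 𝕜) • hadd + (2⁻¹ : 𝕜) • hsub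

variable {ι : Type*} {κ : ℂ}

/-- The superposition of waves of frequency `κ` with amplitudes `c`. -/
def waveMap (κ : ℂ) : EuclideanSpace ℂ (ι × Bool) →ₗ[ℂ] ι → C(unitInterval, ℂ) where
  toFun c e := (wave κ (c (e, false)) (c (e, true))).restrict unitInterval
  map_add' c c' := by
    ext e x
    simp only [wave, PiLp.add_apply, ContinuousMap.restrict_apply, ContinuousMap.coe_mk,
      Pi.add_apply, ContinuousMap.add_apply]
    ring
  map_smul' r c := by
    ext e x
    simp only [wave, PiLp.smul_apply, smul_eq_mul, ContinuousMap.restrict_apply,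
      ContinuousMap.coe_mk, RingHom.id_apply, Pi.smul_apply, ContinuousMap.smul_apply]
    ring

theorem waveMap_apply (c : EuclideanSpace ℂ (ι × Bool)) (e : ι) :
    waveMap κ c e = (wave κ (c (e, false)) (c (e, true))).restrict unitInterval := rfl

theorem isC2_waveMap (c : EuclideanSpace ℂ (ι × Bool)) (e : ι) : IsC2 (waveMap κ c e) :=
  isC2_restrict (contDiff_wave _ _)

theorem waveMap_injective (hκ : κ ≠ 0) :
    Function.Injective (waveMap κ : EuclideanSpace ℂ (ι × Bool) →ₗ[ℂ] _) := by
  refine (injective_iff_map_eq_zero _).2 fun c hc => ?_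
  ext ⟨e, b⟩
  obtain ⟨hfalse, htrue⟩ := eq_zero_of_wave_eq_zero hκ (congrFun hc e)
  cases b
  exacts [hfalse, htrue]

variable [Fintype ι]

/-- The isometry of `EuclideanSpace ℂ (ι × Bool)` that exchanges the two ends of every edge. -/
def flipEnds (ι : Type*) [Fintype ι] :
    EuclideanSpace ℂ (ι × Bool) ≃ₗᵢ[ℂ] EuclideanSpace ℂ (ι × Bool) :=
  LinearIsometryEquiv.piLpCongrLeft 2 ℂ ℂ (Equiv.prodCongr (Equiv.refl ι) Equiv.boolNot)

theorem flipEnds_apply (c : EuclideanSpace ℂ (ι × Bool)) (e : ι) (b : Bool) :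
    flipEnds ι c (e, b) = c (e, !b) := rfl

theorem flipEnds_flipEnds (c : EuclideanSpace ℂ (ι × Bool)) : flipEnds ι (flipEnds ι c) = c := by
  ext ⟨e, b⟩
  rw [flipEnds_apply, flipEnds_apply, Bool.not_not]

/-- The scattering map of the boundary conditions given by `K`: the boundary values and the outer
normal derivatives of a superposition of waves satisfy the conditions iff the incoming amplitudes
are the reflections in `Kᗮ` of the outgoing ones, which then run to the opposite ends. -/
def scattering (K : Submodule ℂ (EuclideanSpace ℂ (ι × Bool))) :
    EuclideanSpace ℂ (ι × Bool) →ₗᵢ[ℂ] EuclideanSpace ℂ (ι × Bool) :=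
  (Kᗮ.reflection.trans (flipEnds ι)).toLinearIsometry

theorem scattering_apply (K : Submodule ℂ (EuclideanSpace ℂ (ι × Bool)))
    (c : EuclideanSpace ℂ (ι × Bool)) : scattering K c = flipEnds ι (Kᗮ.reflection c) := rfl

theorem boundaryValue_waveMap (c : EuclideanSpace ℂ (ι × Bool)) :
    boundaryValue (waveMap κ c) = c + Complex.exp (κ * Complex.I) • flipEnds ι c := by
  ext ⟨e, b⟩
  cases b
  · exact (wave_zero _ _).trans (congrArg _ (mul_comm _ _))
  · exact (wave_one _ _).trans ((add_comm _ _).trans (congrArg _ (mul_comm _ _)))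

theorem normalDer_waveMap (c : EuclideanSpace ℂ (ι × Bool)) :
    normalDer (waveMap κ c)
      = (κ * Complex.I) • (Complex.exp (κ * Complex.I) • flipEnds ι c - c) := by
  ext ⟨e, b⟩
  simp only [normalDer, waveMap_apply, der_restrict (hasDerivAt_wave _ _ _)]
  cases b
  · simp only [endSign, Bool.false_eq_true, ↓reduceIte, endPoint, Icc.coe_zero, wave_zero,
      PiLp.smul_apply, PiLp.sub_apply, flipEnds_apply, Bool.not_false, smul_eq_mul]
    ring
  · simp only [endSign, ↓reduceIte, endPoint, Icc.coe_one, wave_one, PiLp.smul_apply,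
      PiLp.sub_apply, flipEnds_apply, Bool.not_true, smul_eq_mul]
    ring

variable (K : Submodule ℂ (EuclideanSpace ℂ (ι × Bool)))

theorem mem_boundaryDomain_waveMap (hκ : κ ≠ 0) (c : EuclideanSpace ℂ (ι × Bool)) :
    waveMap κ c ∈ boundaryDomain K ↔
      c ∈ End.eigenspace (scattering K).toLinearMap
        (Complex.exp (κ * Complex.I)) := by
  have hflip : flipEnds ι (Complex.exp (κ * Complex.I) • flipEnds ι c)
      = Complex.exp (κ * Complex.I) • c := by rw [map_smul, flipEnds_flipEnds]
  have hK := K.smul_mem_iff (mul_ne_zero hκ Complex.I_ne_zero)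
    (x := Complex.exp (κ * Complex.I) • flipEnds ι c - c)
  rw [End.mem_eigenspace_iff, LinearIsometry.coe_toLinearMap, scattering_apply, ← hflip,
    (flipEnds ι).injective.eq_iff, reflection_orthogonal_eq_iff, ← boundaryValue_waveMap, ← hK,
    ← normalDer_waveMap]
  exact and_iff_right (isC2_waveMap c)

theorem eigenspace_negLaplacian_sq (hκ : κ ≠ 0) :
    eigenspace (negLaplacian K) (κ ^ 2)
      = (End.eigenspace (scattering K).toLinearMap
          (Complex.exp (κ * Complex.I))).map (waveMap κ) := by
  ext u
  rw [mem_eigenspace_negLaplacian, Submodule.mem_map]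
  constructor
  · rintro ⟨hu, heq⟩
    choose a b hab using fun e => exists_eq_wave (hu.1 e) hκ (heq e)
    obtain rfl : waveMap κ (WithLp.toLp 2 fun δ => if δ.2 then b δ.1 else a δ.1) = u :=
      funext fun e => (hab e).symm
    exact ⟨_, (mem_boundaryDomain_waveMap K hκ _).1 hu, rfl⟩
  · rintro ⟨c, hc, rfl⟩
    exact ⟨(mem_boundaryDomain_waveMap K hκ c).2 hc, fun e => neg_der2_wave _ _⟩

theorem geomMult_negLaplacian_sq (hκ : κ ≠ 0) :
    geomMult (negLaplacian K) (κ ^ 2)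
      = finrank ℂ (End.eigenspace (scattering K).toLinearMap
          (Complex.exp (κ * Complex.I))) := by
  rw [geomMult_negLaplacian, eigenspace_negLaplacian_sq K hκ,
    ← (Submodule.equivMapOfInjective _ (waveMap_injective hκ) _).finrank_eq]

theorem exists_pos_sq_of_geomMult_negLaplacian_ne_zero {μ : ℂ} (hμ : μ ≠ 0)
    (h : geomMult (negLaplacian K) μ ≠ 0) : ∃ κ : ℝ, 0 < κ ∧ μ = (κ : ℂ) ^ 2 := by
  obtain ⟨κ, rfl⟩ := IsAlgClosed.exists_pow_nat_eq μ two_pos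
  have hκ : κ ≠ 0 := fun h0 => hμ (by rw [h0, zero_pow two_ne_zero])
  rw [geomMult_negLaplacian_sq K hκ, Nat.cast_ne_zero] at h
  have hbot : End.eigenspace (scattering K).toLinearMap
      (Complex.exp (κ * Complex.I)) ≠ ⊥ := fun h0 => h (by rw [h0, finrank_bot])
  have him : κ.im = 0 := by
    have hnorm := norm_eq_one_of_hasEigenvalue _ (End.hasEigenvalue_iff.2 hbot)
    simpa [Complex.norm_exp] using hnorm
  have hre : κ = (κ.re : ℂ) := Complex.ext rfl (by simpa using him)
  refine ⟨|κ.re|, abs_pos.2 fun h0 => hκ (by rw [hre, h0, Complex.ofReal_zero]), ?_⟩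
  rw [← Complex.ofReal_pow, sq_abs, Complex.ofReal_pow, ← hre]

end Scattering

section Sequences

theorem le_of_monotone_comp_equiv {α : Type*} [Preorder α] {a : ℕ → α} (σ : ℕ ≃ ℕ)
    (ha : Monotone a) (hσ : Monotone (a ∘ σ)) : a ≤ a ∘ σ := by
  intro k
  by_contra hlt
  have hmaps : ∀ i ∈ Finset.Iic k, σ i ∈ Finset.Iio k := fun i hi => by
    rw [Finset.mem_Iio]
    by_contra hik
    exact hlt ((ha (not_lt.1 hik)).trans (hσ (Finset.mem_Iic.1 hi)))
  have hcard := Finset.card_le_card_of_injOn σ hmaps σ.injective.injOn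
  rw [Nat.card_Iic, Nat.card_Iio] at hcard
  exact Nat.not_succ_le_self k hcard

theorem comp_equiv_eq_of_monotone {α : Type*} [PartialOrder α] {a : ℕ → α} (σ : ℕ ≃ ℕ)
    (ha : Monotone a) (hσ : Monotone (a ∘ σ)) : a ∘ σ = a := by
  have hinv : (a ∘ σ) ∘ σ.symm = a := by ext k; simp
  have hle := le_of_monotone_comp_equiv σ.symm hσ (hinv.symm ▸ ha)
  exact (hle.trans_eq hinv).antisymm (le_of_monotone_comp_equiv σ ha hσ)

theorem exists_equiv_of_encard_fiber_eq {α β γ : Type*} [Countable α] [Countable β] {f : α → γ}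
    {g : β → γ} (h : ∀ c, {x | f x = c}.encard = {y | g y = c}.encard) :
    ∃ σ : α ≃ β, g ∘ σ = f := by
  have hfiber : ∀ c, Nonempty ({x // f x = c} ≃ {y // g y = c}) := fun c =>
    Cardinal.lift_mk_eq'.1 <| Cardinal.toENat_injOn
      (Cardinal.lift_le_aleph0.2 Cardinal.mk_le_aleph0)
      (Cardinal.lift_le_aleph0.2 Cardinal.mk_le_aleph0)
      (by rw [Cardinal.toENat_lift, Cardinal.toENat_lift]; exact h c)
  exact ⟨Equiv.ofFiberEquiv fun c => (hfiber c).some, funext (Equiv.ofFiberEquiv_map _)⟩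

theorem IsEigenvalueSequence.unique {X : Type*} [AddCommGroup X] [Module ℂ X] {T : X →ₗ.[ℂ] X}
    {a b : ℕ → ℝ} (ha : IsEigenvalueSequence T a) (hb : IsEigenvalueSequence T b) : a = b := by
  obtain ⟨σ, rfl⟩ := exists_equiv_of_encard_fiber_eq (f := a) (g := b) fun x => by
    simpa only [Complex.ofReal_inj] using (ha.encard_eq x).trans (hb.encard_eq x).symm
  exact comp_equiv_eq_of_monotone σ hb.monotone ha.monotone

theorem tendsto_div_of_abs_sub_le {a : ℕ → ℝ} {c C : ℝ} (h : ∀ i : ℕ, |a i - c * i| ≤ C) (b : ℝ) :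
    Filter.Tendsto (fun i : ℕ => a i / (i + b)) Filter.atTop (nhds c) := by
  have herror : Filter.Tendsto (fun i : ℕ => (a i - c * i) / (i + b)) Filter.atTop (nhds 0) :=
    tendsto_bdd_div_atTop_nhds_zero (.of_forall fun i => (abs_le.1 (h i)).1)
      (.of_forall fun i => (abs_le.1 (h i)).2)
      (Filter.tendsto_atTop_add_const_right _ b tendsto_natCast_atTop_atTop)
  have hmain := herror.add ((tendsto_natCast_div_add_atTop b).const_mul c)
  rw [zero_add, mul_one] at hmain
  exact hmain.congr fun i => by ring

variable {n : ℕ} [NeZero n] {θ : Fin n → ℝ}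

/-- The increasing enumeration of the arithmetic progressions `θ j + 2πℕ`, if
`0 < θ 0 ≤ θ 1 ≤ ⋯ ≤ 2π`. -/
def frequency (θ : Fin n → ℝ) (i : ℕ) : ℝ := θ (Fin.ofNat n i) + 2 * Real.pi * (i / n : ℕ)

theorem frequency_pos (hθ : ∀ j, θ j ∈ Ioc 0 (2 * Real.pi)) (i : ℕ) : 0 < frequency θ i :=
  add_pos_of_pos_of_nonneg (hθ _).1 (by positivity)

theorem monotone_frequency (hmono : Monotone θ) (hθ : ∀ j, θ j ∈ Ioc 0 (2 * Real.pi)) :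
    Monotone (frequency θ) := by
  intro i k hik
  rcases (Nat.div_le_div_right (c := n) hik).eq_or_lt with hq | hq
  · have hmod : Fin.ofNat n i ≤ Fin.ofNat n k := by
      have hi := Nat.div_add_mod i n
      have hk := Nat.div_add_mod k n
      rw [hq] at hi
      change i % n ≤ k % n
      lia
    simpa only [frequency, hq, add_le_add_iff_right] using hmono hmod
  · have hq' : ((i / n : ℕ) : ℝ) + 1 ≤ (k / n : ℕ) := by exact_mod_cast hq
    calc frequency θ i ≤ 2 * Real.pi + 2 * Real.pi * (i / n : ℕ) :=
          add_le_add_left (hθ _).2 _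
      _ = 2 * Real.pi * ((i / n : ℕ) + 1) := by ring
      _ ≤ 2 * Real.pi * (k / n : ℕ) := by gcongr
      _ ≤ frequency θ k := le_add_of_nonneg_left (hθ _).1.le

theorem abs_frequency_sub_le (hθ : ∀ j, θ j ∈ Ioc 0 (2 * Real.pi)) (i : ℕ) :
    |frequency θ i - 2 * Real.pi / n * i| ≤ 2 * Real.pi := by
  have hn : (0 : ℝ) < n := Nat.cast_pos.2 (NeZero.pos n)
  have hi : (i : ℝ) = n * (i / n : ℕ) + (i % n : ℕ) := by exact_mod_cast (Nat.div_add_mod i n).symm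
  have hr0 : 0 ≤ 2 * Real.pi * ((i % n : ℕ) / n) := by positivity
  have hr1 : 2 * Real.pi * ((i % n : ℕ) / n) ≤ 2 * Real.pi :=
    mul_le_of_le_one_right Real.two_pi_pos.le <|
      (div_le_one hn).2 (by exact_mod_cast (Nat.mod_lt i (NeZero.pos n)).le)
  have hsub : frequency θ i - 2 * Real.pi / n * i
      = θ (Fin.ofNat n i) - 2 * Real.pi * ((i % n : ℕ) / n) := by
    rw [frequency, hi]; field_simp; ring
  obtain ⟨hθ0, hθ1⟩ := hθ (Fin.ofNat n i)
  rw [hsub, abs_le]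
  constructor <;> linarith

theorem exp_mul_I_eq_iff_exists_nat {t κ : ℝ} (ht : t ≤ 2 * Real.pi) (hκ : 0 < κ) :
    Complex.exp (t * Complex.I) = Complex.exp (κ * Complex.I)
      ↔ ∃ q : ℕ, t + 2 * Real.pi * q = κ := by
  rw [eq_comm, Complex.exp_eq_exp_iff_exists_int]
  have hcast : ∀ q : ℤ, (κ : ℂ) * Complex.I = t * Complex.I + q * (2 * Real.pi * Complex.I)
      ↔ t + 2 * Real.pi * q = κ := fun q => by
    rw [← mul_assoc, ← add_mul, mul_left_inj' Complex.I_ne_zero, eq_comm, mul_comm (q : ℂ),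
      ← Complex.ofReal_inj]
    norm_cast
  simp only [hcast]
  refine ⟨fun ⟨q, hq⟩ => ?_, fun ⟨q, hq⟩ => ⟨q, by exact_mod_cast hq⟩⟩
  have hpos : 0 < 2 * Real.pi * ((q : ℝ) + 1) := by linarith
  have hq0 : (0 : ℝ) < (q + 1 : ℤ) := by exact_mod_cast pos_of_mul_pos_right hpos Real.two_pi_pos.le
  lift q to ℕ using Int.lt_add_one_iff.1 (Int.cast_pos.1 hq0)
  exact ⟨q, by exact_mod_cast hq⟩

theorem encard_frequency_eq (hθ : ∀ j, θ j ∈ Ioc 0 (2 * Real.pi)) {κ : ℝ} (hκ : 0 < κ) :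
    {i | frequency θ i = κ}.encard
      = {j | Complex.exp (θ j * Complex.I) = Complex.exp (κ * Complex.I)}.encard := by
  have himage : {j | Complex.exp (θ j * Complex.I) = Complex.exp (κ * Complex.I)}
      = (fun i => (Nat.divModEquiv n i).2) '' {i | frequency θ i = κ} := by
    ext j
    rw [mem_ofPred_eq, exp_mul_I_eq_iff_exists_nat (hθ j).2 hκ]
    constructor
    · rintro ⟨q, hq⟩
      have hinv := (Nat.divModEquiv n).apply_symm_apply (q, j)
      refine ⟨(Nat.divModEquiv n).symm (q, j), ?_, congrArg Prod.snd hinv⟩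
      rw [mem_ofPred_eq, ← hq]
      exact congrArg (fun p : ℕ × Fin n => θ p.2 + 2 * Real.pi * p.1) hinv
    · rintro ⟨i, hi, rfl⟩
      exact ⟨i / n, hi⟩
  rw [himage, InjOn.encard_image]
  intro i hi k hk hik
  refine (Nat.divModEquiv n).injective (Prod.ext ?_ hik)
  have heq : frequency θ i = frequency θ k := hi.trans hk.symm
  rw [frequency, frequency, show Fin.ofNat n i = Fin.ofNat n k from hik, add_right_inj,
    mul_right_inj' Real.two_pi_pos.ne'] at heq
  exact_mod_cast heq

/-- The sequence that starts with `m` zeros and goes on with the squares of the frequencies. -/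
def eigenvalueSeq (m : ℕ) (θ : Fin n → ℝ) (k : ℕ) : ℝ :=
  if k < m then 0 else frequency θ (k - m) ^ 2

theorem eigenvalueSeq_add (m i : ℕ) : eigenvalueSeq m θ (i + m) = frequency θ i ^ 2 := by
  rw [eigenvalueSeq, if_neg (Nat.le_add_left m i).not_gt, Nat.add_sub_cancel]

theorem monotone_eigenvalueSeq (m : ℕ) (hmono : Monotone θ)
    (hθ : ∀ j, θ j ∈ Ioc 0 (2 * Real.pi)) : Monotone (eigenvalueSeq m θ) := by
  intro i k hik
  unfold eigenvalueSeq
  split_ifs with hi hk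
  · exact le_rfl
  · positivity
  · exact absurd (hik.trans_lt ‹k < m›) hi
  · exact pow_le_pow_left₀ (frequency_pos hθ _).le
      (monotone_frequency hmono hθ (Nat.sub_le_sub_right hik m)) 2

theorem encard_eigenvalueSeq_eq_zero (m : ℕ) (hθ : ∀ j, θ j ∈ Ioc 0 (2 * Real.pi)) :
    {k | eigenvalueSeq m θ k = 0}.encard = m := by
  have hset : {k | eigenvalueSeq m θ k = 0} = Finset.range m := by
    ext k
    have hne := (frequency_pos hθ (k - m)).ne'
    simp [eigenvalueSeq, hne]
  rw [hset, encard_coe_eq_coe_finsetCard, Finset.card_range]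

theorem encard_eigenvalueSeq_eq_sq (m : ℕ) (hθ : ∀ j, θ j ∈ Ioc 0 (2 * Real.pi)) {κ : ℝ}
    (hκ : 0 < κ) :
    {k | eigenvalueSeq m θ k = κ ^ 2}.encard = {i | frequency θ i = κ}.encard := by
  have hset : {k | eigenvalueSeq m θ k = κ ^ 2} = (· + m) '' {i | frequency θ i = κ} := by
    ext k
    rcases lt_or_ge k m with hk | hk
    · refine iff_of_false ?_ ?_
      · simp [eigenvalueSeq, hk, (pow_pos hκ 2).ne]
      · rintro ⟨i, -, rfl⟩
        exact absurd hk (Nat.le_add_left m i).not_gt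
    · obtain ⟨i, rfl⟩ := Nat.exists_eq_add_of_le' hk
      simp [eigenvalueSeq_add, pow_left_inj₀ (frequency_pos hθ i).le hκ.le]
  rw [hset, (add_left_injective m).encard_image]

theorem tendsto_eigenvalueSeq_div (m : ℕ) (hθ : ∀ j, θ j ∈ Ioc 0 (2 * Real.pi)) :
    Filter.Tendsto (fun k : ℕ => eigenvalueSeq m θ k / ((k : ℝ) + 1) ^ 2) Filter.atTop
      (nhds ((2 * Real.pi / n) ^ 2)) := by
  refine (Filter.tendsto_add_atTop_iff_nat m).1 <|
    ((tendsto_div_of_abs_sub_le (abs_frequency_sub_le hθ) (m + 1)).pow 2).congr fun i => ?_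
  rw [eigenvalueSeq_add, div_pow, Nat.cast_add, add_assoc]

end Sequences

section Spectrum

open Module

variable {ι : Type*} [Fintype ι] (K : Submodule ℂ (EuclideanSpace ℂ (ι × Bool)))

theorem isEigenvalueSequence_eigenvalueSeq {m n : ℕ} [NeZero n] {θ : Fin n → ℝ}
    (hm : geomMult (negLaplacian K) 0 = m) (hmono : Monotone θ)
    (hθ : ∀ j, θ j ∈ Ioc 0 (2 * Real.pi))
    (hcount : ∀ ζ, {j | Complex.exp (θ j * Complex.I) = ζ}.encard
      = finrank ℂ (End.eigenspace (scattering K).toLinearMap ζ)) :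
    IsEigenvalueSequence (negLaplacian K) (eigenvalueSeq m θ) := by
  refine ⟨monotone_eigenvalueSeq m hmono hθ, fun μ => ?_⟩
  by_cases hμ0 : μ = 0
  · simpa only [hμ0, hm, Complex.ofReal_eq_zero] using encard_eigenvalueSeq_eq_zero m hθ
  by_cases hμ : ∃ κ : ℝ, 0 < κ ∧ μ = (κ : ℂ) ^ 2
  · obtain ⟨κ, hκ, rfl⟩ := hμ
    rw [geomMult_negLaplacian_sq K (Complex.ofReal_ne_zero.2 hκ.ne'), ← hcount,
      ← encard_frequency_eq hθ hκ, ← encard_eigenvalueSeq_eq_sq m hθ hκ]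
    norm_cast
  · have hmult : geomMult (negLaplacian K) μ = 0 := by
      by_contra h
      exact hμ (exists_pos_sq_of_geomMult_negLaplacian_ne_zero K hμ0 h)
    rw [hmult, encard_eq_zero, eq_empty_iff_forall_notMem]
    rintro k rfl
    unfold eigenvalueSeq at hμ hμ0
    split_ifs at hμ hμ0 with hk
    · exact hμ0 Complex.ofReal_zero
    · exact hμ ⟨_, frequency_pos hθ _, Complex.ofReal_pow _ _⟩

end Spectrum

section Graph

/-- The vectors indexed by darts that are constant on the darts starting at a common vertex; `s`
assigns to each dart the vertex at which it starts. -/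
def vertexConstant {D V : Type*} (s : D → V) : Submodule ℂ (EuclideanSpace ℂ D) where
  carrier := {c | ∀ δ δ', s δ = s δ' → c δ = c δ'}
  add_mem' hb hc δ δ' h := congrArg₂ (· + ·) (hb δ δ' h) (hc δ δ' h)
  zero_mem' _ _ _ := rfl
  smul_mem' r _ hc δ δ' h := congrArg (r * ·) (hc δ δ' h)

theorem mem_orthogonal_vertexConstant {D V : Type*} [Fintype D] [DecidableEq V] {s : D → V}
    {c : EuclideanSpace ℂ D} : c ∈ (vertexConstant s)ᗮ ↔ ∀ v, ∑ δ with s δ = v, c δ = 0 := by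
  rw [Submodule.mem_orthogonal]
  refine ⟨fun h v => ?_, fun h b hb => ?_⟩
  · have hmem : WithLp.toLp 2 (fun δ => if s δ = v then (1 : ℂ) else 0) ∈ vertexConstant s :=
      fun δ δ' hδ => by simp only [hδ]
    simpa [PiLp.inner_apply, Finset.sum_filter, apply_ite] using h _ hmem
  · rw [PiLp.inner_apply, ← Finset.sum_fiberwise_of_maps_to
      (fun δ _ => Finset.mem_image_of_mem s (Finset.mem_univ δ))]
    refine Finset.sum_eq_zero fun v hv => ?_
    obtain ⟨δ₀, -, rfl⟩ := Finset.mem_image.1 hv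
    calc ∑ δ with s δ = s δ₀, inner ℂ (b δ) (c δ)
        = ∑ δ with s δ = s δ₀, inner ℂ (b δ₀) (c δ) :=
          Finset.sum_congr rfl fun δ hδ => by rw [hb δ δ₀ (Finset.mem_filter.1 hδ).2]
      _ = 0 := by rw [← inner_sum, h, inner_zero_right]

variable {V : Type*} {Γ : SimpleGraph V} (o : Orientation Γ)

/-- The vertex at which a dart starts; the dart `(e, true)` runs through `e` from its head. -/
def Orientation.start (δ : Γ.edgeSet × Bool) : V := if δ.2 then o.head δ.1 else o.tail δ.1

theorem Orientation.head_ne_tail (e : Γ.edgeSet) : o.head e ≠ o.tail e := by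
  have hadj : Γ.Adj (o.tail e) (o.head e) := by
    rw [← SimpleGraph.mem_edgeSet, o.edge_eq e]
    exact e.2
  exact hadj.ne'

theorem Orientation.mem_iff_exists_start {v : V} {e : Γ.edgeSet} :
    v ∈ (e : Sym2 V) ↔ ∃ b, o.start (e, b) = v := by
  rw [← o.edge_eq e, Sym2.mem_iff, Bool.exists_bool, eq_comm, @eq_comm _ v (o.head e)]
  rfl

variable [DecidableEq V]

theorem Orientation.d_start (e : Γ.edgeSet) (b : Bool) : o.d (o.start (e, b)) e = endSign b := by
  cases b <;> simp [Orientation.start, Orientation.d, endSign, o.head_ne_tail e]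

theorem Orientation.pos_start (e : Γ.edgeSet) (b : Bool) :
    o.pos (o.start (e, b)) e = endPoint b := by
  cases b <;> simp [Orientation.start, Orientation.pos, endPoint, o.head_ne_tail e]

theorem Orientation.normalDer_mem_vertexConstant {u : EdgeFun Γ} :
    normalDer u ∈ vertexConstant o.start ↔
      ∀ v, ∀ e f : Γ.edgeSet, v ∈ (e : Sym2 V) → v ∈ (f : Sym2 V) →
        o.d v e * der (u e) (o.pos v e) = o.d v f * der (u f) (o.pos v f) := by
  have hnormal : ∀ (e : Γ.edgeSet) (b : Bool), normalDer u (e, b)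
      = o.d (o.start (e, b)) e * der (u e) (o.pos (o.start (e, b)) e) := fun e b => by
    rw [o.d_start, o.pos_start]; rfl
  refine ⟨fun h v e f he hf => ?_, ?_⟩
  · obtain ⟨b, rfl⟩ := o.mem_iff_exists_start.1 he
    obtain ⟨b', hb'⟩ := o.mem_iff_exists_start.1 hf
    have heq := h (e, b) (f, b') hb'.symm
    rwa [hnormal, hnormal, hb'] at heq
  · rintro h ⟨e, b⟩ ⟨f, b'⟩ hs
    rw [hnormal, hnormal, ← hs]
    exact h _ e f (o.mem_iff_exists_start.2 ⟨b, rfl⟩) (o.mem_iff_exists_start.2 ⟨b', hs.symm⟩)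

variable [Fintype V] [DecidableRel Γ.Adj]

theorem Orientation.sum_d_sq_mul (u : EdgeFun Γ) (v : V) :
    ∑ e, o.d v e ^ 2 * u e (o.pos v e) = ∑ δ with o.start δ = v, boundaryValue u δ := by
  rw [Finset.sum_filter, Fintype.sum_prod_type]
  refine Finset.sum_congr rfl fun e _ => ?_
  rw [Fintype.sum_bool]
  change _ = (if o.head e = v then u e 1 else 0) + if o.tail e = v then u e 0 else 0
  by_cases hhead : o.head e = v
  · have htail : o.tail e ≠ v := fun h => o.head_ne_tail e (hhead.trans h.symm)
    simp [Orientation.d, Orientation.pos, hhead, htail]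
  · by_cases htail : o.tail e = v <;> simp [Orientation.d, Orientation.pos, hhead, htail]

theorem kcDomain_eq_boundaryDomain : kcDomain o = boundaryDomain (vertexConstant o.start) := by
  ext u
  refine and_congr_right fun _ => and_congr ?_ o.normalDer_mem_vertexConstant.symm
  simp only [mem_orthogonal_vertexConstant, o.sum_d_sq_mul]

theorem negLaplacianKC_eq_negLaplacian :
    negLaplacianKC o = negLaplacian (vertexConstant o.start) :=
  LinearPMap.ext (kcDomain_eq_boundaryDomain o) fun _ _ _ => rfl

end Graph

end KCGraph

end

theorem corollary4p3_general {ι : Type*} [Fintype ι] [Nonempty ι]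
    (K : Submodule ℂ (EuclideanSpace ℂ (ι × Bool))) :
    (∀ μ : ℂ, KCGraph.geomMult (KCGraph.negLaplacian K) μ
      = KCGraph.algMult (KCGraph.negLaplacian K) μ) ∧
    (∃ lam : ℕ → ℝ, KCGraph.IsEigenvalueSequence (KCGraph.negLaplacian K) lam) ∧
    (∀ lam : ℕ → ℝ, KCGraph.IsEigenvalueSequence (KCGraph.negLaplacian K) lam →
      Filter.Tendsto (fun k : ℕ => lam k / ((k : ℝ) + 1) ^ 2) Filter.atTop
        (nhds (Real.pi ^ 2 / (Fintype.card ι : ℝ) ^ 2))) := by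
  have : NeZero (Module.finrank ℂ (EuclideanSpace ℂ (ι × Bool))) := ⟨Module.finrank_pos.ne'⟩
  obtain ⟨θ, hmono, hθ, hcount⟩ :=
    KCGraph.exists_monotone_angles_of_linearIsometry (KCGraph.scattering K)
  have hseq := KCGraph.isEigenvalueSequence_eigenvalueSeq K (KCGraph.geomMult_negLaplacian 0)
    hmono hθ hcount
  refine ⟨KCGraph.geomMult_eq_algMult_of_symmetric KCGraph.toL2_injective
    KCGraph.inner_toL2_negLaplacian, ⟨_, hseq⟩, fun lam hlam => ?_⟩
  have hlim : (2 * Real.pi / Module.finrank ℂ (EuclideanSpace ℂ (ι × Bool))) ^ 2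
      = Real.pi ^ 2 / (Fintype.card ι : ℝ) ^ 2 := by
    rw [finrank_euclideanSpace, Fintype.card_prod, Fintype.card_bool, Nat.cast_mul, Nat.cast_two,
      mul_comm, mul_div_mul_right _ _ two_ne_zero, div_pow]
  rw [hlam.unique hseq, ← hlim]
  exact KCGraph.tendsto_eigenvalueSeq_div _ hθ

theorem corollary4p3 {V : Type*} [Fintype V] [DecidableEq V] (Γ : SimpleGraph V)
    [DecidableRel Γ.Adj] (o : KCGraph.Orientation Γ) (hN : 0 < Γ.edgeFinset.card) :
    (∀ μ : ℂ, KCGraph.geomMult (KCGraph.negLaplacianKC o) μ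
      = KCGraph.algMult (KCGraph.negLaplacianKC o) μ) ∧
    (∃ lam : ℕ → ℝ, KCGraph.IsEigenvalueSequence (KCGraph.negLaplacianKC o) lam) ∧
    (∀ lam : ℕ → ℝ, KCGraph.IsEigenvalueSequence (KCGraph.negLaplacianKC o) lam →
      Filter.Tendsto (fun k : ℕ => lam k / ((k : ℝ) + 1) ^ 2) Filter.atTop
        (nhds (Real.pi ^ 2 / (Γ.edgeFinset.card : ℝ) ^ 2))) := by
  have : Nonempty Γ.edgeSet := by
    rwa [← Fintype.card_pos_iff, ← SimpleGraph.edgeFinset_card]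
  rw [KCGraph.negLaplacianKC_eq_negLaplacian, SimpleGraph.edgeFinset_card]
  exact corollary4p3_general _
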